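/- **Theorem.** Coloring Reconfiguration under Color Swapping (CRCS), with the number $k$ of colors part of the input, can be solved in polynomial time on cographs. *Definitions.* A proper $k$-coloring of a finite graph $G=(V,E)$ is a map $f\colon V\to\{1,\dots,k\}$ with $f(u)\neq f(v)$ for every edge $uv\in E$. Two proper $k$-colorings $f,f'$ of $G$ are *adjacent under color swapping* if there is exactly one edge $uv\in E$ with $f(u)=f'(v)$ and $f(v)=f'(u)$, and $f(w)=f'(w)$ for all $w\in V\setminus\{u,v\}$. They are *reconfigurable* if there is a finite sequence $f=f_0,f_1,\dots,f_\ell=f'$ ($\ell\ge 0$) of proper $k$-colorings of $G$ in which consecutive colorings are adjacent under color swapping. An instance of CRCS is a tuple $(G,k,f_s,f_t)$ of a finite graph $G$, an integer $k\geq 1$ and two proper $k$-colorings $f_s,f_t$ of $G$; the question is whether $f_s$ and $f_t$ are reconfigurable. *Cographs* are the graphs obtained from single-vertex graphs by repeatedly taking disjoint unions and joins (the join of two vertex-disjoint graphs is their union together with all edges between them). *Claim.* There are one deterministic algorithm and one polynomial $p$ such that for every instance $(G,k,f_s,f_t)$ of CRCS in which $G$ is a cograph, the algorithm, given $|V|$,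 $k$, the adjacency matrix of $G$ and the two lists of colors, halts after at most $p(N)$ steps and answers correctly whether $f_s$ and $f_t$ are reconfigurable. Here $N$ is the length of the input with numbers written in binary, and steps are those of a random access machine whose elementary operations (copying, addition, truncated subtraction, comparison, indirect memory access; no multiplication) cost one step each, a model polynomially equivalent to Turing machines. -/

import Mathlib

/-! ### Color swapping and cographs -/

namespace CRCS

/-- Two proper `k`-colorings `f`, `f'` of `G` are adjacent under color swapping: there is exactly
one edge `uv` with `f u = f' v` and `f v = f' u`, and `f`, `f'` agree at all other vertices. -/
def SwapAdj {V : Type*} (G : SimpleGraph V) {k : ℕ} (f f' : G.Coloring (Fin k)) : Prop :=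
  ∃ u v : V, G.Adj u v ∧ f u = f' v ∧ f v = f' u ∧
    (∀ x y : V, G.Adj x y → f x = f' y → f y = f' x → s(x, y) = s(u, v)) ∧
    ∀ w : V, w ≠ u → w ≠ v → f w = f' w

/-- `f` and `f'` are reconfigurable: there is a finite sequence `f = f₀, f₁, …, f_ℓ = f'` of
proper `k`-colorings (`ℓ = 0` allowed) in which consecutive colorings are adjacent under color
swapping. -/
def Reconfigurable {V : Type*} (G : SimpleGraph V) {k : ℕ} (f f' : G.Coloring (Fin k)) : Prop :=
  Relation.ReflTransGen (SwapAdj G) f f'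

/-- `IsCographOn G S`: the subgraph of `G` induced by `S` is a cograph, that is, it is built from
single vertices by disjoint unions and joins. -/
inductive IsCographOn {V : Type*} (G : SimpleGraph V) : Set V → Prop
  | single (v : V) : IsCographOn G {v}
  | union (A B : Set V) : IsCographOn G A → IsCographOn G B → Disjoint A B →
      (∀ a ∈ A, ∀ b ∈ B, ¬ G.Adj a b) → IsCographOn G (A ∪ B)
  | join (A B : Set V) : IsCographOn G A → IsCographOn G B → Disjoint A B →
      (∀ a ∈ A, ∀ b ∈ B, G.Adj a b) → IsCographOn G (A ∪ B)

/-- `G` is a cograph. -/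
def IsCograph {V : Type*} (G : SimpleGraph V) : Prop := IsCographOn G Set.univ

/-- An instance `(G, k, f_s, f_t)` of Coloring Reconfiguration under Color Swapping. The vertices
are `0, …, n - 1`; the number `k` of colors is part of the input. -/
structure Instance where
  /-- number of vertices -/
  n : ℕ
  /-- the graph -/
  G : SimpleGraph (Fin n)
  /-- number of colors -/
  k : ℕ
  k_pos : 0 < k
  /-- initial proper coloring -/
  fs : G.Coloring (Fin k)
  /-- target proper coloring -/
  ft : G.Coloring (Fin k)

/-- The yes-instances. -/
def Instance.IsYes (I : Instance) : Prop := Reconfigurable I.G I.fs I.ft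

open Classical in
/-- The encoding of an instance as a list of numbers: `n`, `k`, the adjacency matrix of `G` row by
row, the list of colors of `f_s`, the list of colors of `f_t`. -/
noncomputable def Instance.encode (I : Instance) : List ℕ :=
  [I.n, I.k] ++
    List.ofFn (fun i : Fin (I.n * I.n) => if I.G.Adj i.divNat i.modNat then 1 else 0) ++
    List.ofFn (fun v : Fin I.n => (I.fs v : ℕ)) ++
    List.ofFn (fun v : Fin I.n => (I.ft v : ℕ))

end CRCS

/-! ### Polynomial time

The machine model is a random access machine, programmed with structured control flow. It has
variables and arrays of natural numbers, of which a program can name finitely many. Every elementary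
operation costs one step. The only arithmetic is addition, truncated subtraction and comparison
(no multiplication), so that a run of `t` steps lengthens the numbers in memory by at most `t` bits
and unit cost agrees with Turing machine time up to a polynomial. -/

namespace RAM

/-- The contents of the memory. -/
structure State where
  /-- the value of each variable -/
  var : ℕ → ℕ
  /-- the value of each array at each index -/
  arr : ℕ → ℕ → ℕ

/-- Assign the value `m` to the variable `x`. -/
def State.setVar (s : State) (x m : ℕ) : State :=
  { s with var := Function.update s.var x m }

/-- Store the value `m` in the array `a` at index `i`. -/
def State.setArr (s : State) (a i m : ℕ) : State :=
  { s with arr := Function.update s.arr a (Function.update (s.arr a) i m) }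

/-- Expressions; `get a i` reads the array `a` at index `i`, and a comparison has value 1 if it
holds and 0 if not. -/
inductive Expr
  | const (m : ℕ)
  | var (x : ℕ)
  | get (a : ℕ) (i : Expr)
  | add (e₁ e₂ : Expr)
  | sub (e₁ e₂ : Expr)
  | lt (e₁ e₂ : Expr)
  | eq (e₁ e₂ : Expr)

/-- The value of an expression. -/
def Expr.eval (s : State) : Expr → ℕ
  | .const m => m
  | .var x => s.var x
  | .get a i => s.arr a (i.eval s)
  | .add e₁ e₂ => e₁.eval s + e₂.eval s
  | .sub e₁ e₂ => e₁.eval s - e₂.eval s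
  | .lt e₁ e₂ => if e₁.eval s < e₂.eval s then 1 else 0
  | .eq e₁ e₂ => if e₁.eval s = e₂.eval s then 1 else 0

/-- The number of elementary operations in the evaluation of an expression. -/
def Expr.cost : Expr → ℕ
  | .const _ => 1
  | .var _ => 1
  | .get _ i => i.cost + 1
  | .add e₁ e₂ => e₁.cost + e₂.cost + 1
  | .sub e₁ e₂ => e₁.cost + e₂.cost + 1
  | .lt e₁ e₂ => e₁.cost + e₂.cost + 1
  | .eq e₁ e₂ => e₁.cost + e₂.cost + 1

/-- Programs: no operation, assignment to a variable, assignment to an array entry, sequential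
composition, case distinction (is the value of `e` nonzero?), and `while e ≠ 0 do p`. -/
inductive Prog
  | noop
  | assign (x : ℕ) (e : Expr)
  | store (a : ℕ) (i e : Expr)
  | seq (p q : Prog)
  | cond (e : Expr) (p q : Prog)
  | loop (e : Expr) (p : Prog)

/-- `Exec p s t s'`: the program `p`, started in `s`, halts after exactly `t` steps in `s'`. -/
inductive Exec : Prog → State → ℕ → State → Prop
  | noop (s : State) : Exec .noop s 1 s
  | assign (s : State) (x : ℕ) (e : Expr) :
      Exec (.assign x e) s (e.cost + 1) (s.setVar x (e.eval s))
  | store (s : State) (a : ℕ) (i e : Expr) :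
      Exec (.store a i e) s (i.cost + e.cost + 1) (s.setArr a (i.eval s) (e.eval s))
  | seq {s s' s'' : State} {p q : Prog} {t t' : ℕ} :
      Exec p s t s' → Exec q s' t' s'' → Exec (.seq p q) s (t + t') s''
  | cond_true {s s' : State} {e : Expr} {p q : Prog} {t : ℕ} :
      e.eval s ≠ 0 → Exec p s t s' → Exec (.cond e p q) s (e.cost + 1 + t) s'
  | cond_false {s s' : State} {e : Expr} {p q : Prog} {t : ℕ} :
      e.eval s = 0 → Exec q s t s' → Exec (.cond e p q) s (e.cost + 1 + t) s'
  | loop_true {s s' s'' : State} {e : Expr} {p : Prog} {t t' : ℕ} :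
      e.eval s ≠ 0 → Exec p s t s' → Exec (.loop e p) s' t' s'' →
      Exec (.loop e p) s (e.cost + 1 + t + t') s''
  | loop_false {s : State} {e : Expr} {p : Prog} :
      e.eval s = 0 → Exec (.loop e p) s (e.cost + 1) s

/-- The initial memory on the input `L`: array 0 holds the entries of `L`, variable 0 holds the
length of `L`, and everything else is 0. -/
def State.init (L : List ℕ) : State where
  var := fun x => if x = 0 then L.length else 0
  arr := fun a i => if a = 0 then L.getD i 0 else 0

/-- The size of an input: the total number of binary digits, plus one separator per entry. -/
def inputSize (L : List ℕ) : ℕ := (L.map fun m => m.size + 1).sum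

/-- The decision problem `Yes` on the instances in `Dom`, encoded by `enc`, is solvable in
polynomial time: one program halts on every instance in `Dom` within a number of steps that is
polynomial in the input size, with 1 in variable 0 on yes-instances and 0 on no-instances. -/
def SolvableInPolyTime {α : Type*} (enc : α → List ℕ) (Dom Yes : α → Prop) : Prop :=
  ∃ (p : Prog) (b : Polynomial ℕ), ∀ I : α, Dom I →
    ∃ (t : ℕ) (s : State), Exec p (State.init (enc I)) t s ∧
      t ≤ b.eval (inputSize (enc I)) ∧
      (Yes I → s.var 0 = 1) ∧ (¬ Yes I → s.var 0 = 0)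

end RAM

/-! Only the absence of induced four-vertex paths is used. For an edge `xy`, `core G x y` is the
cotree module at which `x` and `y` are joined. Cores that meet are nested (`core_nested`), and the
colors of `x` and `y` may be swapped exactly when each is unique in that core (`active_iff`).

This suggests the criterion `Cond G f f'`: each color `f v` occurs in `f'` at `v` itself, or at some
`w` sharing with `v` the core of an active edge in which the color of `v` is unique. A swap
preserves the criterion (`Cond.of_swap`) and `f'` satisfies it for itself, so it is necessary. For
sufficiency, a smallest core containing a misplaced unique color and its destination allows an
exchange that reduces the number of misplaced vertices (`Cond.exists_exchange`,
`Active.reconfigurable_swap`).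

`Cond` is a first-order formula whose quantifiers range over the vertices, nested to depth six.
Brute-force evaluation is therefore polynomial; `PolyDecidable` is closed under connectives and
bounded quantifiers, and yields the program. -/

namespace CRCS

/-! ### Cores in graphs without induced four-vertex paths. -/

section Structure

variable {V : Type*} {G : SimpleGraph V}

/-- There is no induced path on four vertices. -/
def P4Free (G : SimpleGraph V) : Prop :=
  ∀ ⦃a b c d : V⦄, G.Adj a b → G.Adj b c → G.Adj c d → G.Adj a c ∨ G.Adj b d ∨ G.Adj a d

/-- In a disjoint union a path stays on one side. In a join, a path meeting both sides has a chord,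
because the complement of a four-vertex path is connected. -/
theorem IsCographOn.p4Free {S : Set V} (h : IsCographOn G S) :
    ∀ a ∈ S, ∀ b ∈ S, ∀ c ∈ S, ∀ d ∈ S, G.Adj a b → G.Adj b c → G.Adj c d →
      G.Adj a c ∨ G.Adj b d ∨ G.Adj a d := by
  induction h with
  | single v =>
    rintro a rfl b rfl c - d - hab
    exact absurd hab (G.irrefl)
  | union A B _ _ _ hAB ihA ihB =>
    intro a ha b hb c hc d hd hab hbc hcd
    have key : ∀ {x y}, x ∈ A → y ∈ A ∪ B → G.Adj x y → y ∈ A := fun hx hy hxy =>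
      hy.resolve_right fun hy => hAB _ hx _ hy hxy
    have key' : ∀ {x y}, x ∈ B → y ∈ A ∪ B → G.Adj x y → y ∈ B := fun hx hy hxy =>
      hy.resolve_left fun hy => hAB _ hy _ hx hxy.symm
    rcases ha with ha | ha
    · have hb := key ha hb hab
      have hc := key hb hc hbc
      exact ihA a ha b hb c hc d (key hc hd hcd) hab hbc hcd
    · have hb := key' ha hb hab
      have hc := key' hb hc hbc
      exact ihB a ha b hb c hc d (key' hc hd hcd) hab hbc hcd
  | join A B _ _ _ hAB ihA ihB =>
    intro a ha b hb c hc d hd hab hbc hcd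
    have hBA : ∀ x ∈ B, ∀ y ∈ A, G.Adj x y := fun x hx y hy => (hAB y hy x hx).symm
    rcases ha with ha | ha <;> rcases hb with hb | hb <;> rcases hc with hc | hc <;>
      rcases hd with hd | hd <;> grind

theorem IsCograph.p4Free (h : IsCograph G) : P4Free G := fun a b c d =>
  IsCographOn.p4Free h a trivial b trivial c trivial d trivial

/-- For an edge `xy` of a cograph, the set of leaves below the lowest common ancestor of `x` and
`y` in the cotree. -/
def core (G : SimpleGraph V) (x y : V) : Set V :=
  {w | (G.Adj w x ∨ G.Adj w y) ∧ ∀ z, G.Adj z w → G.Adj z x ∨ G.Adj z y}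

theorem core_comm (x y : V) : core G x y = core G y x := by
  ext w; simp only [core, Set.mem_ofPred_eq, or_comm]

theorem left_mem_core {x y : V} (h : G.Adj x y) : x ∈ core G x y :=
  ⟨.inr h, fun _ hz => .inl hz⟩

theorem right_mem_core {x y : V} (h : G.Adj x y) : y ∈ core G x y :=
  ⟨.inl h.symm, fun _ hz => .inr hz⟩

theorem core_subset_core {a b x y : V}
    (h : ∀ z, G.Adj z a ∨ G.Adj z b → G.Adj z x ∨ G.Adj z y) : core G a b ⊆ core G x y :=
  fun w hw => ⟨h w hw.1, fun z hz => h z (hw.2 z hz)⟩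

theorem core_subset_of_mem {a b x y : V} (ha : a ∈ core G x y) (hb : b ∈ core G x y) :
    core G a b ⊆ core G x y :=
  core_subset_core fun z hz => hz.elim (ha.2 z) (hb.2 z)

/-- `core G x y` is a module: a vertex outside that sees one of its vertices sees them all. -/
theorem adj_core_of_adj (hG : P4Free G) {x y z w v : V} (hxy : G.Adj x y)
    (hz : z ∉ core G x y) (hw : w ∈ core G x y) (hzw : G.Adj z w) (hv : v ∈ core G x y) :
    G.Adj z v := by
  have hd := hw.2 z hzw
  -- Since `z` sees `x` or `y`, it can be outside the core only through a neighbor `q` that sees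
  -- neither. Then `q, z, x, y` forces `z` to see both ends, and a non-neighbor `v` of `z` would end
  -- an induced path starting with `q, z`.
  obtain ⟨q, hqz, hq⟩ : ∃ q, G.Adj q z ∧ ¬ (G.Adj q x ∨ G.Adj q y) := by
    by_contra! h
    exact hz ⟨hd, fun u hu => or_iff_not_imp_left.2 fun h1 => by
      by_contra h2; exact absurd (h u hu) (by tauto)⟩
  have hqv : ¬ G.Adj q v := fun h => hq (hv.2 q h)
  have hzx : G.Adj z x ∧ G.Adj z y := by
    have h1 := @hG q z x y hqz
    have h2 := @hG q z y x hqz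
    have := hxy.symm
    tauto
  by_contra hzv
  rcases hv.1 with h | h
  · have := hG hqz hzx.1 h.symm; tauto
  · have := hG hqz hzx.2 h.symm; tauto

/-- Two cores with a common vertex are nested. -/
theorem core_nested (hG : P4Free G) {x y a b w : V} (hxy : G.Adj x y) (hab : G.Adj a b)
    (h1 : w ∈ core G x y) (h2 : w ∈ core G a b) :
    core G x y ⊆ core G a b ∨ core G a b ⊆ core G x y := by
  by_contra! h
  obtain ⟨p, hp1, hp2⟩ : ∃ p, (G.Adj p x ∨ G.Adj p y) ∧ ¬ (G.Adj p a ∨ G.Adj p b) := by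
    by_contra! h'
    exact h.1 (core_subset_core fun z hz => by have := h' z hz; tauto)
  obtain ⟨q, hq1, hq2⟩ : ∃ q, (G.Adj q a ∨ G.Adj q b) ∧ ¬ (G.Adj q x ∨ G.Adj q y) := by
    by_contra! h'
    exact h.2 (core_subset_core fun z hz => by have := h' z hz; tauto)
  have hpM : ∀ u ∈ core G a b, ¬ G.Adj p u := fun u hu hpu => hp2 (hu.2 p hpu)
  have hqM : ∀ u ∈ core G x y, ¬ G.Adj q u := fun u hu hqu => hq2 (hu.2 q hqu)
  have hx := left_mem_core hxy
  have hy := right_mem_core hxy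
  -- Otherwise the module property would make `q` adjacent to the common vertex `w`, which lies in
  -- `core G x y`.
  have hq : q ∈ core G a b := by
    by_contra hq
    rcases hq1 with hqa | hqa
    · exact hqM w h1 (adj_core_of_adj hG hab hq (left_mem_core hab) hqa h2)
    · exact hqM w h1 (adj_core_of_adj hG hab hq (right_mem_core hab) hqa h2)
  have out : ∀ u ∈ core G x y, u ∉ core G a b → ∀ v ∈ core G a b, ¬ G.Adj u v :=
    fun u hu hu' v hv huv => hqM u hu (adj_core_of_adj hG hab hu' hv huv hq).symm
  by_cases hxM : x ∈ core G a b
  · have hyM : y ∈ core G a b := by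
      by_contra hyM
      exact out y hy hyM x hxM hxy.symm
    exact hp1.elim (hpM x hxM) (hpM y hyM)
  · by_cases hyM : y ∈ core G a b
    · exact out x hx hxM y hyM hxy
    · exact h1.1.elim (fun h => out x hx hxM w h2 h.symm) (fun h => out y hy hyM w h2 h.symm)

theorem core_subset_of_adj (hG : P4Free G) {x y a b : V} (hxy : G.Adj x y) (hab : G.Adj a b)
    (ha : a ∈ core G x y) (hb : b ∉ core G x y) : core G x y ⊆ core G a b :=
  (core_nested hG hxy hab ha (left_mem_core hab)).resolve_right fun h => hb (h (right_mem_core hab))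

/-- In the cotree, `b` lies below a child of the join node of `xy` other than that of `x`, or below
the same child as `x` and hence a different one from `y`. The two alternatives correspond to these
cases. -/
theorem core_eq_or_eq (hG : P4Free G) {x y b : V} (hxy : G.Adj x y) (hb : b ∈ core G x y)
    (hbx : G.Adj b x) :
    core G x b = core G x y ∨ G.Adj b y ∧ core G b y = core G x y := by
  by_cases hz : ∃ z, G.Adj z y ∧ ¬ G.Adj z x ∧ ¬ G.Adj z b
  · obtain ⟨z, hzy, hzx, hzb⟩ := hz
    have hby : G.Adj b y := by
      by_contra hby
      have := hG hzy hxy.symm hbx.symm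
      have := G.adj_comm b y
      tauto
    refine .inr ⟨hby, (core_subset_of_mem hb (right_mem_core hxy)).antisymm
      (core_subset_core fun u hu => ?_)⟩
    by_contra! h
    have hux : G.Adj u x := hu.resolve_right h.2
    have h1 := hG hux hxy hzy.symm
    have h2 := @hG b y z u hby hzy.symm
    have := G.adj_comm u z
    have := G.adj_comm x z
    have := G.adj_comm b z
    have := G.adj_comm y u
    have := G.adj_comm b u
    tauto
  · push Not at hz
    refine .inl ((core_subset_of_mem (left_mem_core hxy) hb).antisymm
      (core_subset_core fun u hu => ?_))
    have := hz u
    tauto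

end Structure

/-! ### Legal swaps and the invariance of the criterion. -/

section Activity

variable {V α : Type*} {G : SimpleGraph V}

/-- No other vertex of `S` has the color of `v`. -/
def UniqueIn (f : V → α) (S : Set V) (v : V) : Prop := ∀ u ∈ S, f u = f v → u = v

theorem UniqueIn.mono {f : V → α} {S T : Set V} {v : V} (h : UniqueIn f T v) (hST : S ⊆ T) :
    UniqueIn f S v := fun u hu => h u (hST hu)

/-- The colors of `x` and `y` may be swapped, see `active_iff`. -/
def Active (G : SimpleGraph V) (f : V → α) (x y : V) : Prop :=
  G.Adj x y ∧ UniqueIn f (core G x y) x ∧ UniqueIn f (core G x y) y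

theorem Active.symm {f : V → α} {x y : V} (h : Active G f x y) : Active G f y x :=
  ⟨h.1.symm, core_comm x y ▸ h.2.2, core_comm x y ▸ h.2.1⟩

/-- The right side says that the swap keeps the coloring proper. A neighbor of `y` with the color of
`x` is not adjacent to `x`, so the missing induced path places it in the core. -/
theorem active_iff (hG : P4Free G) {f : V → α} (hf : ∀ u v, G.Adj u v → f u ≠ f v) {x y : V} :
    Active G f x y ↔ G.Adj x y ∧ (∀ u, G.Adj u y → f u = f x → u = x) ∧
      ∀ u, G.Adj u x → f u = f y → u = y := by
  have key : ∀ {x y}, G.Adj x y → UniqueIn f (core G x y) x → ∀ u, G.Adj u y → f u = f x →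
      u = x := by
    intro x y hxy hx z hzy hzx
    refine hx z ⟨.inr hzy, fun q hqz => ?_⟩ hzx
    have h1 := hG hqz hzy hxy.symm
    have h2 := hf z x
    tauto
  refine ⟨fun h => ⟨h.1, key h.1 h.2.1, key h.1.symm h.symm.2.1⟩, fun h => ⟨h.1, ?_, ?_⟩⟩
  · intro u hu hux
    exact h.2.1 u (hu.1.resolve_left fun h => hf _ _ h hux) hux
  · intro u hu huy
    exact h.2.2 u (hu.1.resolve_right fun h => hf _ _ h huy) huy

/-- Every color of `f` occurs in `f'` at a place to which it can be moved. -/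
def Cond (G : SimpleGraph V) (f f' : V → α) : Prop :=
  ∀ v, ∃ w, f' w = f v ∧ (w = v ∨ ∃ x y, Active G f x y ∧ v ∈ core G x y ∧ w ∈ core G x y ∧
    UniqueIn f (core G x y) v)

theorem Cond.refl (f : V → α) : Cond G f f := fun v => ⟨v, rfl, .inl rfl⟩

variable [DecidableEq V]

theorem swap_mem_iff {S : Set V} {a b : V} (hab : a ∈ S ↔ b ∈ S) (v : V) :
    Equiv.swap a b v ∈ S ↔ v ∈ S := by
  rw [Equiv.swap_apply_def]; split_ifs <;> simp_all

theorem uniqueIn_comp_swap {f : V → α} {S : Set V} {a b v : V} (hab : a ∈ S ↔ b ∈ S)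
    (h : UniqueIn (f ∘ Equiv.swap a b) S v) : UniqueIn f S (Equiv.swap a b v) := by
  intro u hu huv
  have := h (Equiv.swap a b u) ((swap_mem_iff hab u).2 hu) (by simpa using huv)
  rw [← this, Equiv.swap_apply_self]

theorem UniqueIn.comp_swap {f : V → α} {S : Set V} {a b v : V} (hab : a ∈ S ↔ b ∈ S)
    (h : UniqueIn f S v) : UniqueIn (f ∘ Equiv.swap a b) S (Equiv.swap a b v) := by
  refine uniqueIn_comp_swap hab ?_
  intro u hu huv
  exact h u hu (by simpa using huv)

/-- A swap inside a core leaves an active edge with the same core. -/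
theorem Active.of_swap_inside (hG : P4Free G) {f : V → α} {a b x y : V} (hab : Active G f a b)
    (hxy : Active G (f ∘ Equiv.swap a b) x y) (ha : a ∈ core G x y) (hb : b ∈ core G x y) :
    ∃ x' y', Active G f x' y' ∧ core G x' y' = core G x y := by
  have key : ∀ {b x y : V}, Active G f x b → Active G (f ∘ Equiv.swap x b) x y →
      b ∈ core G x y → ∃ x' y', Active G f x' y' ∧ core G x' y' = core G x y := by
    intro b x y hxb hxy hb
    by_cases hby : b = y
    · subst hby; exact ⟨x, b, hxb, rfl⟩
    have hm : x ∈ core G x y ↔ b ∈ core G x y := by simp [hb, left_mem_core hxy.1]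
    -- Either the swapped edge `xb` itself spans the core, or `by` does; the latter was active
    -- before the swap because `b` then held the color now at `x`.
    rcases core_eq_or_eq hG hxy.1 hb hxb.1.symm with h | ⟨hby', h⟩
    · exact ⟨x, b, hxb, h⟩
    · have h1 := uniqueIn_comp_swap hm hxy.2.1
      have h2 := uniqueIn_comp_swap hm hxy.2.2
      rw [Equiv.swap_apply_left] at h1
      rw [Equiv.swap_apply_of_ne_of_ne hxy.1.ne' (Ne.symm hby)] at h2
      exact ⟨b, y, ⟨hby', h ▸ h1, h ▸ h2⟩, h⟩
  have key2 : ∀ {a b x y : V}, Active G f a b → Active G (f ∘ Equiv.swap a b) x y →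
      a ∈ core G x y → b ∈ core G x y → x = a ∨ x = b →
      ∃ x' y', Active G f x' y' ∧ core G x' y' = core G x y := by
    rintro a b x y hab hxy ha hb (rfl | rfl)
    · exact key hab hxy hb
    · exact key hab.symm (Equiv.swap_comm a x ▸ hxy) ha
  by_cases hx : x = a ∨ x = b
  · exact key2 hab hxy ha hb hx
  by_cases hy : y = a ∨ y = b
  · rw [core_comm x y] at ha hb ⊢
    exact key2 hab hxy.symm ha hb hy
  push Not at hx hy
  have hm : a ∈ core G x y ↔ b ∈ core G x y := by simp [ha, hb]
  have h1 := uniqueIn_comp_swap hm hxy.2.1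
  have h2 := uniqueIn_comp_swap hm hxy.2.2
  rw [Equiv.swap_apply_of_ne_of_ne hx.1 hx.2] at h1
  rw [Equiv.swap_apply_of_ne_of_ne hy.1 hy.2] at h2
  exact ⟨x, y, ⟨hxy.1, h1, h2⟩, rfl⟩

theorem uniqueIn_of_swap_boundary {f : V → α} {S : Set V} {a b v : V} (hb : b ∉ S)
    (ha : UniqueIn f S a) (hv : v ∈ S) (h : UniqueIn (f ∘ Equiv.swap a b) S v) :
    UniqueIn f S v := by
  intro u hu huv
  by_cases hva : v = a
  · subst hva; exact ha u hu huv
  by_cases hua : u = a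
  · subst hua; exact (ha v hv huv.symm).symm
  refine h u hu ?_
  have hub : u ≠ b := fun h => hb (h ▸ hu)
  have hvb : v ≠ b := fun h => hb (h ▸ hv)
  simp [Equiv.swap_apply_of_ne_of_ne, *]

/-- As `ab` leaves `core G x y`, nestedness puts that core inside `core G a b`. Thus the color of
`a` was already unique there, and the witness `xy` survives unless `v = b`, where `ab` replaces it.
-/
theorem Cond.of_swap_boundary (hG : P4Free G) {f : V → α} {a b x y v w : V} (hab : Active G f a b)
    (hxy : Active G (f ∘ Equiv.swap a b) x y) (ha : a ∈ core G x y) (hb : b ∉ core G x y)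
    (hv : Equiv.swap a b v ∈ core G x y) (hw : w ∈ core G x y)
    (hu : UniqueIn (f ∘ Equiv.swap a b) (core G x y) (Equiv.swap a b v)) :
    ∃ x y, Active G f x y ∧ v ∈ core G x y ∧ w ∈ core G x y ∧ UniqueIn f (core G x y) v := by
  have hsub := core_subset_of_adj hG hxy.1 hab.1 ha hb
  have ha' := hab.2.1.mono hsub
  by_cases hvb : v = b
  · subst hvb
    exact ⟨a, v, hab, right_mem_core hab.1, hsub hw, hab.2.2⟩
  have hva : v ≠ a := by
    rintro rfl; exact hb (by simpa using hv)
  rw [Equiv.swap_apply_of_ne_of_ne hva hvb] at hv hu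
  exact ⟨x, y, ⟨hxy.1, uniqueIn_of_swap_boundary hb ha' (left_mem_core hxy.1) hxy.2.1,
    uniqueIn_of_swap_boundary hb ha' (right_mem_core hxy.1) hxy.2.2⟩, hv, hw,
    uniqueIn_of_swap_boundary hb ha' hv hu⟩

/-- The cases are how many of `a`, `b` lie in the witnessing core: with both, uniqueness is permuted
inside it; with one, the boundary lemma applies; with none, the swap fixes the core pointwise. -/
theorem Cond.of_swap (hG : P4Free G) {f f' : V → α} {a b : V} (hab : Active G f a b)
    (h : Cond G (f ∘ Equiv.swap a b) f') : Cond G f f' := by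
  intro v
  obtain ⟨w, hwv, hw⟩ := h (Equiv.swap a b v)
  refine ⟨w, by simpa using hwv, ?_⟩
  rcases hw with rfl | ⟨x, y, hxy, hv, hw, hu⟩
  · by_cases hva : v = a
    · subst hva
      exact .inr ⟨v, b, hab, left_mem_core hab.1, by simpa using right_mem_core hab.1, hab.2.1⟩
    by_cases hvb : v = b
    · subst hvb
      exact .inr ⟨a, v, hab, right_mem_core hab.1, by simpa using left_mem_core hab.1, hab.2.2⟩
    exact .inl (Equiv.swap_apply_of_ne_of_ne hva hvb)
  right
  by_cases ha : a ∈ core G x y <;> by_cases hb : b ∈ core G x y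
  · obtain ⟨x', y', h1, h2⟩ := hab.of_swap_inside hG hxy ha hb
    have hm : a ∈ core G x y ↔ b ∈ core G x y := by simp [ha, hb]
    have := uniqueIn_comp_swap hm hu
    rw [Equiv.swap_apply_self] at this
    exact ⟨x', y', h1, h2 ▸ (swap_mem_iff hm v).1 hv, h2 ▸ hw, h2 ▸ this⟩
  · exact Cond.of_swap_boundary hG hab hxy ha hb hv hw hu
  · rw [Equiv.swap_comm] at hxy hv hu
    exact Cond.of_swap_boundary hG hab.symm hxy hb ha hv hw hu
  · have hm : a ∈ core G x y ↔ b ∈ core G x y := by simp [ha, hb]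
    have hs : ∀ u ∈ core G x y, Equiv.swap a b u = u := fun u hu =>
      Equiv.swap_apply_of_ne_of_ne (fun h => ha (h ▸ hu)) (fun h => hb (h ▸ hu))
    have h1 := uniqueIn_comp_swap hm hxy.2.1
    have h2 := uniqueIn_comp_swap hm hxy.2.2
    have h3 := uniqueIn_comp_swap hm hu
    rw [hs _ (left_mem_core hxy.1)] at h1
    rw [hs _ (right_mem_core hxy.1)] at h2
    rw [Equiv.swap_apply_self] at h3
    exact ⟨x, y, ⟨hxy.1, h1, h2⟩, (swap_mem_iff hm v).1 hv, hw, h3⟩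

end Activity

/-! ### Sufficiency of the criterion. -/

section Reconfiguration

variable {V : Type*} {G : SimpleGraph V} {k : ℕ}

theorem SwapAdj.symm {f f' : G.Coloring (Fin k)} (h : SwapAdj G f f') : SwapAdj G f' f := by
  obtain ⟨a, b, hab, h1, h2, h3, h4⟩ := h
  refine ⟨a, b, hab, h2.symm, h1.symm, fun x y hxy h h' => h3 x y hxy h'.symm h.symm, ?_⟩
  exact fun w ha hb => (h4 w ha hb).symm

theorem Reconfigurable.symm {f f' : G.Coloring (Fin k)} (h : Reconfigurable G f f') :
    Reconfigurable G f' f := by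
  induction h with
  | refl => exact .refl
  | tail _ h ih => exact ih.head h.symm

/-- If `f` satisfies the condition for `f' ≠ f`, then some misplaced color can be exchanged with
the color at its destination. -/
theorem Cond.exists_exchange (hG : P4Free G) [Finite V] {α : Type*} {f f' : V → α}
    (h : Cond G f f') (hne : f ≠ f') :
    ∃ x y v w, Active G f x y ∧ v ∈ core G x y ∧ w ∈ core G x y ∧ UniqueIn f (core G x y) v ∧
      UniqueIn f (core G x y) w ∧ v ≠ w ∧ f v ≠ f' v ∧ f w ≠ f' w ∧ f' w = f v := by
  let P : ℕ → Prop := fun m => ∃ x y v w, Active G f x y ∧ v ∈ core G x y ∧ w ∈ core G x y ∧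
    UniqueIn f (core G x y) v ∧ v ≠ w ∧ f v ≠ f' v ∧ f' w = f v ∧ (core G x y).ncard = m
  have step : ∀ v, f v ≠ f' v → ∃ x y w, Active G f x y ∧ v ∈ core G x y ∧ w ∈ core G x y ∧
      UniqueIn f (core G x y) v ∧ v ≠ w ∧ f' w = f v := by
    intro v hv
    obtain ⟨w, hw, rfl | ⟨x, y, h1, h2, h3, h4⟩⟩ := h v
    · exact absurd hw.symm hv
    · exact ⟨x, y, w, h1, h2, h3, h4, by rintro rfl; exact hv hw.symm, hw⟩
  have hP : ∃ m, P m := by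
    obtain ⟨v, hv⟩ := Function.ne_iff.1 hne
    obtain ⟨x, y, w, h1, h2, h3, h4, h5, h6⟩ := step v hv
    exact ⟨_, x, y, v, w, h1, h2, h3, h4, h5, hv, h6, rfl⟩
  classical
  obtain ⟨x, y, v, w, h1, h2, h3, h4, h5, h6, h7, h8⟩ := Nat.find_spec hP
  -- A correctly colored `w` would share the color of `v`, against uniqueness in the core.
  have hw : f w ≠ f' w := fun he => h5 (h4 w h3 (he.trans h7)).symm
  refine ⟨x, y, v, w, h1, h2, h3, h4, ?_, h5, h6, hw, h7⟩
  obtain ⟨x', y', w', g1, g2, g3, g4, g5, g6⟩ := step w hw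
  -- The core witnessing the move of the color of `w` either contains the chosen one, so uniqueness
  -- restricts, or is contained in it and equals it by minimality.
  rcases core_nested hG h1.1 g1.1 h3 g2 with hs | hs
  · exact g4.mono hs
  · have hle : Nat.find hP ≤ (core G x' y').ncard :=
      Nat.find_min' hP ⟨x', y', w, w', g1, g2, g3, g4, g5, hw, g6, rfl⟩
    rw [← h8] at hle
    rwa [Set.eq_of_subset_of_ncard_le hs hle] at g4

variable [DecidableEq V]

theorem SwapAdj.exists_active (hG : P4Free G) {f f' : G.Coloring (Fin k)} (h : SwapAdj G f f') :
    ∃ a b, Active G f a b ∧ (f' : V → Fin k) = f ∘ Equiv.swap a b := by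
  obtain ⟨a, b, hab, h1, h2, -, h3⟩ := h
  refine ⟨a, b, (active_iff hG fun u v => f.valid).2 ⟨hab, ?_, ?_⟩, ?_⟩
  · intro u hu hua
    by_contra hne
    exact f'.valid hu (by rw [← h3 u hne hu.ne, hua, h1])
  · intro u hu hub
    by_contra hne
    exact f'.valid hu (by rw [← h3 u hu.ne hne, hub, h2])
  · funext w
    by_cases hwa : w = a
    · subst hwa; simp [h2]
    by_cases hwb : w = b
    · subst hwb; simp [h1]
    simp [Equiv.swap_apply_of_ne_of_ne hwa hwb, h3 w hwa hwb]

theorem Active.exists_swapAdj (hG : P4Free G) {f : G.Coloring (Fin k)} {a b : V}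
    (h : Active G f a b) :
    ∃ f' : G.Coloring (Fin k), (f' : V → Fin k) = f ∘ Equiv.swap a b ∧ SwapAdj G f f' := by
  obtain ⟨hab, h1, h2⟩ := (active_iff hG fun u v => f.valid).1 h
  have hval : ∀ {u v}, G.Adj u v → f (Equiv.swap a b u) ≠ f (Equiv.swap a b v) := by
    intro u v huv he
    have := f.valid huv
    have := f.valid hab
    have := huv.symm
    have := h1 u
    have := h2 u
    have := h1 v
    have := h2 v
    simp only [Equiv.swap_apply_def] at he
    grind
  refine ⟨SimpleGraph.Coloring.mk (f ∘ Equiv.swap a b) hval, rfl, a, b, hab, ?_, ?_, ?_, ?_⟩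
  · change f a = f (Equiv.swap a b b); simp
  · change f b = f (Equiv.swap a b a); simp
  · intro x y hxy
    change f x = f (Equiv.swap a b y) → f y = f (Equiv.swap a b x) → _
    have := f.valid hxy
    simp only [Equiv.swap_apply_def]
    grind [Sym2.eq_swap]
  · intro w hwa hwb
    change f w = f (Equiv.swap a b w)
    rw [Equiv.swap_apply_of_ne_of_ne hwa hwb]

theorem Reconfigurable.cond_trans (hG : P4Free G) {f f' : G.Coloring (Fin k)} {g : V → Fin k}
    (h : Reconfigurable G f f') (hg : Cond G f' g) : Cond G f g := by
  induction h using Relation.ReflTransGen.head_induction_on with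
  | refl => exact hg
  | head h _ ih =>
    obtain ⟨a, b, hab, he⟩ := h.exists_active hG
    exact Cond.of_swap hG hab (he ▸ ih)

/-- The colors of two adjacent vertices with unique colors in a core can be exchanged. -/
theorem exists_swapAdj_of_uniqueIn (hG : P4Free G) {f : G.Coloring (Fin k)} {x y v w : V}
    (hv : v ∈ core G x y) (hw : w ∈ core G x y) (hvu : UniqueIn f (core G x y) v)
    (hwu : UniqueIn f (core G x y) w) (hvw : G.Adj v w) :
    ∃ f' : G.Coloring (Fin k), (f' : V → Fin k) = f ∘ Equiv.swap v w ∧ SwapAdj G f f' :=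
  have hsub := core_subset_of_mem hv hw
  Active.exists_swapAdj hG ⟨hvw, hvu.mono hsub, hwu.mono hsub⟩

/-- This is `(v c)(w c)(v c) = (v w)`. Swaps inside the core only permute the unique colors, so
every intermediate swap is legal. -/
theorem reconfigurable_swap_via (hG : P4Free G) {f : G.Coloring (Fin k)} {x y v w c : V}
    (hv : v ∈ core G x y) (hw : w ∈ core G x y) (hc : c ∈ core G x y)
    (hvu : UniqueIn f (core G x y) v) (hwu : UniqueIn f (core G x y) w)
    (hcu : UniqueIn f (core G x y) c) (hvw : v ≠ w) (hvc : G.Adj v c) (hwc : G.Adj w c) :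
    ∃ f' : G.Coloring (Fin k), (f' : V → Fin k) = f ∘ Equiv.swap v w ∧ Reconfigurable G f f' := by
  have m1 : v ∈ core G x y ↔ c ∈ core G x y := by simp [hv, hc]
  have m2 : w ∈ core G x y ↔ c ∈ core G x y := by simp [hw, hc]
  have sw : Equiv.swap v c w = w := Equiv.swap_apply_of_ne_of_ne hvw.symm hwc.ne
  have sv : Equiv.swap w c v = v := Equiv.swap_apply_of_ne_of_ne hvw hvc.ne
  obtain ⟨f1, e1, r1⟩ := exists_swapAdj_of_uniqueIn hG hv hc hvu hcu hvc
  have v1 : UniqueIn f1 (core G x y) v := by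
    have := hcu.comp_swap m1; rwa [Equiv.swap_apply_right, ← e1] at this
  have c1 : UniqueIn f1 (core G x y) c := by
    have := hvu.comp_swap m1; rwa [Equiv.swap_apply_left, ← e1] at this
  have w1 : UniqueIn f1 (core G x y) w := by
    have := hwu.comp_swap m1; rwa [sw, ← e1] at this
  obtain ⟨f2, e2, r2⟩ := exists_swapAdj_of_uniqueIn hG hw hc w1 c1 hwc
  have v2 : UniqueIn f2 (core G x y) v := by
    have := v1.comp_swap m2; rwa [sv, ← e2] at this
  have c2 : UniqueIn f2 (core G x y) c := by
    have := w1.comp_swap m2; rwa [Equiv.swap_apply_left, ← e2] at this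
  obtain ⟨f3, e3, r3⟩ := exists_swapAdj_of_uniqueIn hG hv hc v2 c2 hvc
  refine ⟨f3, ?_, ((Relation.ReflTransGen.single r1).tail r2).tail r3⟩
  rw [e3, e2, e1]
  funext u
  have := hvc.ne
  have := hwc.ne
  simp only [Function.comp_apply, Equiv.swap_apply_def]
  grind

/-- The colors of any two vertices with unique colors in the core of an active edge can be
exchanged. -/
theorem Active.reconfigurable_swap (hG : P4Free G) {f : G.Coloring (Fin k)} {x y v w : V}
    (hxy : Active G f x y) (hv : v ∈ core G x y) (hw : w ∈ core G x y)
    (hvu : UniqueIn f (core G x y) v) (hwu : UniqueIn f (core G x y) w) (hvw : v ≠ w) :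
    ∃ f' : G.Coloring (Fin k), (f' : V → Fin k) = f ∘ Equiv.swap v w ∧ Reconfigurable G f f' := by
  by_cases h : G.Adj v w
  · obtain ⟨f', e, r⟩ := exists_swapAdj_of_uniqueIn hG hv hw hvu hwu h
    exact ⟨f', e, .single r⟩
  have hx := left_mem_core hxy.1
  have hy := right_mem_core hxy.1
  -- Without a common neighbor among `x` and `y`, either `v, x, y, w` or `w, x, y, v` would be an
  -- induced path.
  have key : (G.Adj v x ∧ G.Adj w x) ∨ (G.Adj v y ∧ G.Adj w y) := by
    have h1 := hv.1
    have h2 := hw.1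
    have h3 := @hG v x y w
    have h4 := @hG w x y v
    have := hxy.1
    have := G.adj_comm v w
    have := G.adj_comm v y
    have := G.adj_comm w y
    tauto
  rcases key with ⟨h1, h2⟩ | ⟨h1, h2⟩
  · exact reconfigurable_swap_via hG hv hw hx hvu hwu hxy.2.1 hvw h1 h2
  · exact reconfigurable_swap_via hG hv hw hy hvu hwu hxy.2.2 hvw h1 h2

/-- Induction on a bound for the number of misplaced vertices: an exchange corrects `w`, and `v` was
misplaced already. -/
theorem Cond.reconfigurable (hG : P4Free G) [Fintype V] {f' : G.Coloring (Fin k)} :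
    ∀ (m : ℕ) (f : G.Coloring (Fin k)), {u | f u ≠ f' u}.ncard ≤ m → Cond G f f' →
      Reconfigurable G f f' := by
  intro m
  induction m with
  | zero =>
    intro f hm _
    have : f = f' := by
      rw [Nat.le_zero, Set.ncard_eq_zero, Set.eq_empty_iff_forall_notMem] at hm
      exact DFunLike.ext _ _ fun u => not_not.1 (hm u)
    exact this ▸ .refl
  | succ m ih =>
    intro f hm hc
    by_cases hne : (f : V → Fin k) = f'
    · exact DFunLike.coe_injective hne ▸ .refl
    obtain ⟨x, y, v, w, hxy, hv, hw, hvu, hwu, hvw, hv', hw', he⟩ := hc.exists_exchange hG hne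
    obtain ⟨g, hg, hr⟩ := hxy.reconfigurable_swap hG hv hw hvu hwu hvw
    -- Reversibility of swaps carries the criterion forward from `f` to `g`.
    refine hr.trans (ih g ?_ (hr.symm.cond_trans hG hc))
    refine Nat.le_of_lt_succ (lt_of_lt_of_le (Set.ncard_lt_ncard ?_) hm)
    refine ⟨fun u hu => ?_, fun hs => hs hw' ?_⟩
    · by_cases huv : u = v
      · exact huv ▸ hv'
      by_cases huw : u = w
      · exact huw ▸ hw'
      have hgu : g u = f u := by
        rw [hg, Function.comp_apply, Equiv.swap_apply_of_ne_of_ne huv huw]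
      exact fun h => hu (hgu.trans h)
    · rw [hg, Function.comp_apply, Equiv.swap_apply_right, he]

theorem reconfigurable_iff_cond (hG : P4Free G) [Fintype V] (f f' : G.Coloring (Fin k)) :
    Reconfigurable G f f' ↔ Cond G f f' :=
  ⟨fun h => h.cond_trans hG (Cond.refl _), Cond.reconfigurable hG _ f le_rfl⟩

end Reconfiguration

end CRCS

/-! ### Programs for formulas with bounded quantifiers. -/

namespace RAM

open Polynomial in
/-- Evaluation of a polynomial over `ℕ` is monotone. -/
theorem eval_le_eval (b : ℕ[X]) {m n : ℕ} (h : m ≤ n) : b.eval m ≤ b.eval n := by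
  rw [eval_eq_sum, eval_eq_sum]
  exact Finset.sum_le_sum fun i _ => Nat.mul_le_mul_left _ (Nat.pow_le_pow_left h i)

/-- A loop that runs through the states described by `Inv 0`, `Inv 1`, …, `Inv n` halts. -/
theorem exists_exec_loop {e : Expr} {p : Prog} {n T : ℕ} (Inv : ℕ → State → Prop)
    (hlt : ∀ i s, i < n → Inv i s → e.eval s ≠ 0)
    (hend : ∀ s, Inv n s → e.eval s = 0)
    (hstep : ∀ i s, i < n → Inv i s → ∃ t s', Exec p s t s' ∧ t ≤ T ∧ Inv (i + 1) s')
    {s : State} (h0 : Inv 0 s) :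
    ∃ t s', Exec (.loop e p) s t s' ∧ t ≤ n * (e.cost + 1 + T) + (e.cost + 1) ∧ Inv n s' := by
  suffices ∀ j i s, i + j = n → Inv i s →
      ∃ t s', Exec (.loop e p) s t s' ∧ t ≤ j * (e.cost + 1 + T) + (e.cost + 1) ∧ Inv n s' from
    this n 0 s (by simp) h0
  intro j
  induction j with
  | zero =>
    rintro i s rfl hs
    exact ⟨_, s, .loop_false (hend s hs), by simp, hs⟩
  | succ j ih =>
    intro i s hi hs
    obtain ⟨t, s', h1, h2, h3⟩ := hstep i s (by omega) hs
    obtain ⟨t', s'', g1, g2, g3⟩ := ih (i + 1) s' (by omega) h3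
    refine ⟨_, s'', .loop_true (hlt i s (by omega) hs) h1 g1, ?_, g3⟩
    rw [Nat.succ_mul]; omega

/-- The memory of arrays. -/
abbrev Arrays := ℕ → ℕ → ℕ

/-- `φ` depends on the variables `0, …, c - 1` only. -/
def Local (c : ℕ) (φ : Arrays → (ℕ → ℕ) → Prop) : Prop :=
  ∀ A v v', (∀ x < c, v x = v' x) → (φ A v ↔ φ A v')

/-- The predicate `φ` of the arrays and the variables `0, …, c - 1` is decided, with the result in
the variable `c`, by a program that changes no array and none of the variables `0, …, c - 1`, in
time polynomial in the entry `0` of the array `0`. -/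
def PolyDecidable (c : ℕ) (φ : Arrays → (ℕ → ℕ) → Prop) : Prop :=
  Local c φ ∧ ∃ (p : Prog) (b : Polynomial ℕ), ∀ s : State, ∃ t s', Exec p s t s' ∧
    t ≤ b.eval (s.arr 0 0) ∧ s'.arr = s.arr ∧ (∀ x < c, s'.var x = s.var x) ∧
    (φ s.arr s.var → s'.var c = 1) ∧ (¬ φ s.arr s.var → s'.var c = 0)

theorem PolyDecidable.congr {c : ℕ} {φ ψ : Arrays → (ℕ → ℕ) → Prop} (h : PolyDecidable c φ)
    (hφψ : ∀ A v, φ A v ↔ ψ A v) : PolyDecidable c ψ := by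
  obtain rfl : φ = ψ := by funext A v; exact propext (hφψ A v)
  exact h

theorem PolyDecidable.atom {c : ℕ} {φ : Arrays → (ℕ → ℕ) → Prop} (e : Expr) (hloc : Local c φ)
    (he : ∀ s : State, e.eval s ≠ 0 ↔ φ s.arr s.var) : PolyDecidable c φ := by
  refine ⟨hloc, .assign c (.lt (.const 0) e), Polynomial.C ((Expr.lt (.const 0) e).cost + 1),
    fun s => ⟨_, _, .assign s c _, by simp, rfl, fun x hx => ?_, fun h => ?_, fun h => ?_⟩⟩
  · simp [State.setVar, hx.ne]
  · simp [State.setVar, Expr.eval, Nat.pos_iff_ne_zero, (he s).2 h]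
  · have : e.eval s = 0 := not_not.1 (mt (he s).1 h)
    simp [State.setVar, Expr.eval, this]

theorem PolyDecidable.not {c : ℕ} {φ : Arrays → (ℕ → ℕ) → Prop} (h : PolyDecidable c φ) :
    PolyDecidable c fun A v => ¬ φ A v := by
  obtain ⟨hloc, p, b, hp⟩ := h
  refine ⟨fun A v v' hv => not_congr (hloc A v v' hv),
    .seq p (.assign c (.sub (.const 1) (.var c))), b + Polynomial.C 4, fun s => ?_⟩
  obtain ⟨t, s', h1, h2, h3, h4, h5, h6⟩ := hp s
  refine ⟨_, _, .seq h1 (.assign s' c _), ?_, h3, fun x hx => ?_, fun h => ?_, fun h => ?_⟩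
  · simpa [Expr.cost] using h2
  · simp [State.setVar, hx.ne, h4 x hx]
  · simp [State.setVar, Expr.eval, h6 h]
  · simp [State.setVar, Expr.eval, h5 (not_not.1 h)]

/-- Variable `c` keeps the first verdict while the second is computed from `c + 1` on. Locality
ensures that the first program's writes do not affect `ψ`. -/
theorem PolyDecidable.and {c : ℕ} {φ ψ : Arrays → (ℕ → ℕ) → Prop} (h : PolyDecidable c φ)
    (hψ : Local c ψ) (h' : PolyDecidable (c + 1) ψ) : PolyDecidable c fun A v => φ A v ∧ ψ A v := by
  obtain ⟨hloc, p, b, hp⟩ := h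
  obtain ⟨-, q, b', hq⟩ := h'
  refine ⟨fun A v v' hv => and_congr (hloc A v v' hv) (hψ A v v' hv),
    .seq p (.seq q (.assign c (.lt (.const 1) (.add (.var c) (.var (c + 1)))))),
    b + (b' + Polynomial.C 6), fun s => ?_⟩
  obtain ⟨t, s', h1, h2, h3, h4, h5, h6⟩ := hp s
  obtain ⟨t', s'', g1, g2, g3, g4, g5, g6⟩ := hq s'
  have hψ' : ψ s'.arr s'.var ↔ ψ s.arr s.var := h3 ▸ hψ _ _ _ h4
  rw [hψ'] at g5 g6
  have hc : s''.var c = s'.var c := g4 c (by omega)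
  refine ⟨_, _, .seq h1 (.seq g1 (.assign s'' c _)), ?_, g3.trans h3, fun x hx => ?_,
    fun h => ?_, fun h => ?_⟩
  · rw [h3] at g2
    simp only [Polynomial.eval_add, Polynomial.eval_C, Expr.cost]; omega
  · simp [State.setVar, hx.ne, g4 x (by omega), h4 x hx]
  · simp [State.setVar, Expr.eval, hc, h5 h.1, g5 h.2]
  · by_cases hφ : φ s.arr s.var
    · simp [State.setVar, Expr.eval, hc, h5 hφ, g6 fun hψ => h ⟨hφ, hψ⟩]
    · by_cases hψ : ψ s.arr s.var
      · simp [State.setVar, Expr.eval, hc, h6 hφ, g5 hψ]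
      · simp [State.setVar, Expr.eval, hc, h6 hφ, g6 hψ]

/-- Variable `c` accumulates the disjunction and `c + 1` is the loop counter, so the body starts at
`c + 2`. -/
theorem PolyDecidable.exists_lt {c : ℕ} {φ : ℕ → Arrays → (ℕ → ℕ) → Prop} (hφ : ∀ m, Local c (φ m))
    (h : PolyDecidable (c + 2) fun A v => φ (v (c + 1)) A v) :
    PolyDecidable c fun A v => ∃ m < A 0 0, φ m A v := by
  obtain ⟨-, p, b, hp⟩ := h
  have hloc : Local c fun A v => ∃ m < A 0 0, φ m A v := fun A v v' hv =>
    exists_congr fun m => and_congr_right fun _ => hφ m A v v' hv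
  let body : Prog := .seq p (.seq (.assign c (.lt (.const 0) (.add (.var c) (.var (c + 2)))))
    (.assign (c + 1) (.add (.var (c + 1)) (.const 1))))
  refine ⟨hloc, .seq (.assign c (.const 0)) (.seq (.assign (c + 1) (.const 0))
    (.loop (.lt (.var (c + 1)) (.get 0 (.const 0))) body)),
    -- Each round adds 5 steps for the test and 10 for the two assignments; initialization costs 4
    -- and the last test 5.
    Polynomial.X * (b + Polynomial.C 15) + Polynomial.C 9, fun s => ?_⟩
  let Inv : ℕ → State → Prop := fun i s' => s'.arr = s.arr ∧ (∀ x < c, s'.var x = s.var x) ∧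
    s'.var (c + 1) = i ∧ ((∃ m < i, φ m s.arr s.var) → s'.var c = 1) ∧
    ((¬ ∃ m < i, φ m s.arr s.var) → s'.var c = 0)
  have h0 : Inv 0 ((s.setVar c 0).setVar (c + 1) 0) := by
    refine ⟨rfl, fun x hx => ?_, ?_, ?_, ?_⟩
    · simp [State.setVar, hx.ne, (show x ≠ c + 1 by omega)]
    all_goals simp [State.setVar]
  have hexec := exists_exec_loop (n := s.arr 0 0)
    (e := .lt (.var (c + 1)) (.get 0 (.const 0))) (p := body) (T := b.eval (s.arr 0 0) + 10)
    Inv ?_ ?_ ?_ h0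
  · obtain ⟨t, s', h1, h2, h3, h4, -, h5, h6⟩ := hexec
    refine ⟨_, s', .seq (.assign s c _) (.seq (.assign _ (c + 1) _) h1), ?_, h3, h4, h5, h6⟩
    simp only [Expr.cost] at h2 ⊢
    simp only [Polynomial.eval_add, Polynomial.eval_mul, Polynomial.eval_X, Polynomial.eval_C]
    rw [show b.eval (s.arr 0 0) + 15 = 1 + (1 + 1) + 1 + 1 + (b.eval (s.arr 0 0) + 10) by ring]
    omega
  · rintro i s' hi ⟨h1, -, h2, -⟩
    simp [Expr.eval, h1, h2, hi]
  · rintro s' ⟨h1, -, h2, -⟩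
    simp [Expr.eval, h1, h2]
  · rintro i s1 hi ⟨a1, a2, a3, a4, a5⟩
    obtain ⟨t, s', h1, h2, h3, h4, h5, h6⟩ := hp s1
    have hφ' : φ (s1.var (c + 1)) s1.arr s1.var ↔ φ i s.arr s.var := by
      rw [a3, a1]; exact hφ i _ _ _ a2
    beta_reduce at h5 h6
    rw [hφ'] at h5 h6
    have e1 : s'.var c = s1.var c := h4 c (by omega)
    have e2 : s'.var (c + 1) = i := (h4 _ (by omega)).trans a3
    have hex : (∃ m < i + 1, φ m s.arr s.var) ↔ (∃ m < i, φ m s.arr s.var) ∨ φ i s.arr s.var := by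
      constructor
      · rintro ⟨m, hm, h⟩
        rcases Nat.lt_succ_iff_lt_or_eq.1 hm with hm | rfl
        exacts [.inl ⟨m, hm, h⟩, .inr h]
      · rintro (⟨m, hm, h⟩ | h)
        exacts [⟨m, by omega, h⟩, ⟨i, by omega, h⟩]
    refine ⟨_, _, .seq h1 (.seq (.assign s' c _) (.assign _ (c + 1) _)), ?_, h3.trans a1,
      fun x hx => ?_, ?_, ?_, ?_⟩
    · rw [a1] at h2
      simp only [Expr.cost]; omega
    · simp [State.setVar, hx.ne, (show x ≠ c + 1 by omega), h4 x (by omega), a2 x hx]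
    · simp [State.setVar, Expr.eval, e2]
    all_goals
      rw [hex]
      by_cases b1 : ∃ m < i, φ m s.arr s.var <;> by_cases b2 : φ i s.arr s.var <;>
        simp [State.setVar, Expr.eval, e1, a4, a5, h5, h6, b1, b2, -not_exists]

theorem Local.not {c : ℕ} {φ : Arrays → (ℕ → ℕ) → Prop} (h : Local c φ) :
    Local c fun A v => ¬ φ A v := fun A v v' hv => not_congr (h A v v' hv)

theorem PolyDecidable.forall_lt {c : ℕ} {φ : ℕ → Arrays → (ℕ → ℕ) → Prop} (hφ : ∀ m, Local c (φ m))
    (h : PolyDecidable (c + 2) fun A v => φ (v (c + 1)) A v) :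
    PolyDecidable c fun A v => ∀ m < A 0 0, φ m A v :=
  (PolyDecidable.exists_lt (φ := fun m A v => ¬ φ m A v) (fun m => (hφ m).not) h.not).not.congr
    fun A v => by push Not; rfl

theorem PolyDecidable.or {c : ℕ} {φ ψ : Arrays → (ℕ → ℕ) → Prop} (h : PolyDecidable c φ)
    (hψ : Local c ψ) (h' : PolyDecidable (c + 1) ψ) : PolyDecidable c fun A v => φ A v ∨ ψ A v :=
  (h.not.and hψ.not h'.not).not.congr fun A v => by tauto

theorem PolyDecidable.imp {c : ℕ} {φ ψ : Arrays → (ℕ → ℕ) → Prop} (h : PolyDecidable c φ)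
    (hψ : Local c ψ) (h' : PolyDecidable (c + 1) ψ) : PolyDecidable c fun A v => φ A v → ψ A v :=
  (h.and hψ.not h'.not).not.congr fun A v => by tauto

theorem local_of_forall {c : ℕ} {φ : Arrays → (ℕ → ℕ) → Prop}
    (h : ∀ A v v', (∀ x < c, v x = v' x) → φ A v = φ A v') : Local c φ :=
  fun A v v' hv => iff_of_eq (h A v v' hv)

/-! ### The criterion as a formula about arrays. -/

/-- Adjacency, read off the arrays. Array `0` holds the encoding, array `1` the row offsets. -/
def Arrays.Adj (A : Arrays) (u v : ℕ) : Prop := A 0 (A 1 u + v) ≠ 0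

/-- The initial color of `v`. -/
def Arrays.source (A : Arrays) (v : ℕ) : ℕ := A 0 (A 1 (A 0 0) + v)

/-- The target color of `v`. -/
def Arrays.target (A : Arrays) (v : ℕ) : ℕ := A 0 (A 1 (A 0 0) + A 0 0 + v)

/-- The counterpart of `CRCS.core`. -/
def Arrays.Core (A : Arrays) (x y w : ℕ) : Prop :=
  (A.Adj w x ∨ A.Adj w y) ∧ ∀ z < A 0 0, A.Adj z w → A.Adj z x ∨ A.Adj z y

/-- The counterpart of `CRCS.UniqueIn`. -/
def Arrays.Uniq (A : Arrays) (x y v : ℕ) : Prop :=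
  ∀ u < A 0 0, A.Core x y u → A.source u = A.source v → u = v

/-- The counterpart of `CRCS.Active`. -/
def Arrays.Act (A : Arrays) (x y : ℕ) : Prop := A.Adj x y ∧ A.Uniq x y x ∧ A.Uniq x y y

/-- The counterpart of `CRCS.Cond`. -/
def Arrays.Cond (A : Arrays) : Prop :=
  ∀ v < A 0 0, ∃ w < A 0 0, A.target w = A.source v ∧ (w = v ∨ ∃ x < A 0 0, ∃ y < A 0 0,
    A.Act x y ∧ A.Core x y v ∧ A.Core x y w ∧ A.Uniq x y v)

theorem polyDecidable_adj {c x y : ℕ} (hx : x < c) (hy : y < c) :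
    PolyDecidable c fun A v => A.Adj (v x) (v y) :=
  .atom (.get 0 (.add (.get 1 (.var x)) (.var y)))
    (local_of_forall fun A v v' h => by simp only [h x hx, h y hy]) fun s => Iff.rfl

theorem polyDecidable_eq {c x y : ℕ} (hx : x < c) (hy : y < c) :
    PolyDecidable c fun _ v => v x = v y :=
  .atom (.eq (.var x) (.var y))
    (local_of_forall fun A v v' h => by simp only [h x hx, h y hy])
    fun s => by simp only [Expr.eval]; split_ifs <;> simp_all

theorem polyDecidable_source_eq {c x y : ℕ} (hx : x < c) (hy : y < c) :
    PolyDecidable c fun A v => A.source (v x) = A.source (v y) :=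
  .atom (.eq (.get 0 (.add (.get 1 (.get 0 (.const 0))) (.var x)))
      (.get 0 (.add (.get 1 (.get 0 (.const 0))) (.var y))))
    (local_of_forall fun A v v' h => by simp only [h x hx, h y hy])
    fun s => by simp only [Expr.eval, Arrays.source]; split_ifs <;> simp_all

theorem polyDecidable_target_eq {c x y : ℕ} (hx : x < c) (hy : y < c) :
    PolyDecidable c fun A v => A.target (v x) = A.source (v y) :=
  .atom (.eq (.get 0 (.add (.add (.get 1 (.get 0 (.const 0))) (.get 0 (.const 0))) (.var x)))
      (.get 0 (.add (.get 1 (.get 0 (.const 0))) (.var y))))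
    (local_of_forall fun A v v' h => by simp only [h x hx, h y hy])
    fun s => by simp only [Expr.eval, Arrays.source, Arrays.target]; split_ifs <;> simp_all

theorem polyDecidable_core {c x y w : ℕ} (hx : x < c) (hy : y < c) (hw : w < c) :
    PolyDecidable c fun A v => A.Core (v x) (v y) (v w) := by
  refine PolyDecidable.and
    (.or (polyDecidable_adj hw hx) ?_ (polyDecidable_adj (by omega) (by omega))) ?_
    (.forall_lt (φ := fun m A v => A.Adj m (v w) → A.Adj m (v x) ∨ A.Adj m (v y)) ?_
      (.imp (polyDecidable_adj (by omega) (by omega)) ?_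
        (.or (polyDecidable_adj (by omega) (by omega)) ?_
          (polyDecidable_adj (by omega) (by omega)))))
  all_goals
    first
    | refine local_of_forall fun A v v' h => ?_
    | refine fun m => local_of_forall fun A v v' h => ?_
    simp (disch := omega) only [h _ _]

theorem polyDecidable_uniq {c x y w : ℕ} (hx : x < c) (hy : y < c) (hw : w < c) :
    PolyDecidable c fun A v => A.Uniq (v x) (v y) (v w) := by
  refine PolyDecidable.forall_lt
    (φ := fun m A v => A.Core (v x) (v y) m → A.source m = A.source (v w) → m = v w) ?_
    (.imp (polyDecidable_core (by omega) (by omega) (by omega)) ?_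
      (.imp (polyDecidable_source_eq (by omega) (by omega)) ?_
        (polyDecidable_eq (by omega) (by omega))))
  all_goals
    first
    | refine local_of_forall fun A v v' h => ?_
    | refine fun m => local_of_forall fun A v v' h => ?_
    simp (disch := omega) only [h _ _]

theorem polyDecidable_act {c x y : ℕ} (hx : x < c) (hy : y < c) :
    PolyDecidable c fun A v => A.Act (v x) (v y) := by
  refine PolyDecidable.and (polyDecidable_adj hx hy) ?_
    (.and (polyDecidable_uniq (by omega) (by omega) (by omega)) ?_
      (polyDecidable_uniq (by omega) (by omega) (by omega)))
  all_goals
    refine local_of_forall fun A v v' h => ?_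
    simp (disch := omega) only [h _ _]

theorem polyDecidable_cond (c : ℕ) : PolyDecidable c fun A _ => A.Cond := by
  refine PolyDecidable.forall_lt (φ := fun a A _ => ∃ b < A 0 0, A.target b = A.source a ∧
      (b = a ∨ ∃ x < A 0 0, ∃ y < A 0 0, A.Act x y ∧ A.Core x y a ∧ A.Core x y b ∧ A.Uniq x y a))
    ?_ (.exists_lt (φ := fun b A v => A.target b = A.source (v (c + 1)) ∧
      (b = v (c + 1) ∨ ∃ x < A 0 0, ∃ y < A 0 0, A.Act x y ∧ A.Core x y (v (c + 1)) ∧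
        A.Core x y b ∧ A.Uniq x y (v (c + 1)))) ?_
      (.and (polyDecidable_target_eq (by omega) (by omega)) ?_
        (.or (polyDecidable_eq (by omega) (by omega)) ?_
          (.exists_lt (φ := fun x A v => ∃ y < A 0 0, A.Act x y ∧ A.Core x y (v (c + 1)) ∧
            A.Core x y (v (c + 2 + 1)) ∧ A.Uniq x y (v (c + 1))) ?_
            -- Each quantifier reserves two variables and each connective one: the outer counters
            -- are at `c + 1` and `c + 2 + 1`, and the counter for `x` at `c + 2 + 2 + 1 + 1 + 1`.
            (.exists_lt (φ := fun y A v => A.Act (v (c + 2 + 2 + 1 + 1 + 1)) y ∧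
              A.Core (v (c + 2 + 2 + 1 + 1 + 1)) y (v (c + 1)) ∧
              A.Core (v (c + 2 + 2 + 1 + 1 + 1)) y (v (c + 2 + 1)) ∧
              A.Uniq (v (c + 2 + 2 + 1 + 1 + 1)) y (v (c + 1))) ?_
              (.and (polyDecidable_act (by omega) (by omega)) ?_
                (.and (polyDecidable_core (by omega) (by omega) (by omega)) ?_
                  (.and (polyDecidable_core (by omega) (by omega) (by omega)) ?_
                    (polyDecidable_uniq (by omega) (by omega) (by omega))))))))))
  all_goals
    first
    | refine local_of_forall fun A v v' h => ?_
    | refine fun m => local_of_forall fun A v v' h => ?_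
    first | rfl | simp (disch := omega) only [h _ _]

end RAM

/-! ### Correctness of the encoding. -/

namespace CRCS

section Encoding

open RAM

variable (I : Instance) {A : Arrays}

theorem Instance.getD_encode_zero : I.encode.getD 0 0 = I.n := by simp [Instance.encode]

theorem Instance.getD_encode_adj (u v : Fin I.n) :
    I.encode.getD (2 + u * I.n + v) 0 ≠ 0 ↔ I.G.Adj u v := by
  have hlt : u * I.n + v < I.n * I.n := by
    have := Nat.mul_le_mul_right I.n (Nat.succ_le_of_lt u.2)
    rw [Nat.succ_mul] at this
    have := v.2
    omega
  have hn : 0 < I.n := u.pos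
  have h1 : (⟨u * I.n + v, hlt⟩ : Fin (I.n * I.n)).divNat = u := by
    ext; simp [Fin.divNat, Nat.mul_add_div hn, mul_comm, Nat.div_eq_of_lt v.2]
  have h2 : (⟨u * I.n + v, hlt⟩ : Fin (I.n * I.n)).modNat = v := by
    ext; simp [Fin.modNat, Nat.mod_eq_of_lt v.2]
  have h3 : 2 + u * I.n + v - [I.n, I.k].length = u * I.n + v := by
    simp only [List.length_cons, List.length_nil]; omega
  rw [Instance.encode, List.append_assoc, List.append_assoc, List.getD_append_right _ _ _ _
    (by simp; omega), h3, List.getD_append _ _ _ _ (by simpa using hlt),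
    List.getD_eq_getElem _ _ (by simpa using hlt), List.getElem_ofFn, h1, h2]
  split_ifs <;> simp_all

theorem Instance.getD_encode_source (v : Fin I.n) :
    I.encode.getD (2 + I.n * I.n + v) 0 = I.fs v := by
  have := v.2
  rw [Instance.encode, List.append_assoc, List.getD_append_right _ _ _ _ (by simp; omega),
    List.getD_append _ _ _ _ (by simp; omega), List.getD_eq_getElem _ _ (by simp; omega),
    List.getElem_ofFn]
  congr 2
  ext; simp; omega

theorem Instance.getD_encode_target (v : Fin I.n) :
    I.encode.getD (2 + I.n * I.n + I.n + v) 0 = I.ft v := by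
  have := v.2
  rw [Instance.encode, List.getD_append_right _ _ _ _ (by simp; omega),
    List.getD_eq_getElem _ _ (by simp; omega), List.getElem_ofFn]
  congr 2
  ext; simp; omega

theorem Instance.n_le_inputSize : I.n ≤ inputSize I.encode := by
  have h : I.encode.length ≤ inputSize I.encode := by
    simp [inputSize, List.sum_map_add]
  refine le_trans ?_ h
  simp [Instance.encode]; omega

/-- The arrays hold the encoding of `I` and the row offsets. -/
structure Represents (A : Arrays) (I : Instance) : Prop where
  input : ∀ i, A 0 i = I.encode.getD i 0
  offset : ∀ u ≤ I.n, A 1 u = 2 + u * I.n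

namespace Represents

variable {I} (h : Represents A I)
include h

theorem size : A 0 0 = I.n := (h.input 0).trans I.getD_encode_zero

theorem adj (u v : Fin I.n) : A.Adj u v ↔ I.G.Adj u v := by
  rw [Arrays.Adj, h.offset u u.2.le, h.input, I.getD_encode_adj]

theorem source (v : Fin I.n) : A.source v = I.fs v := by
  rw [Arrays.source, h.size, h.offset _ le_rfl, h.input, I.getD_encode_source]

theorem target (v : Fin I.n) : A.target v = I.ft v := by
  rw [Arrays.target, h.size, h.offset _ le_rfl, h.input, I.getD_encode_target]

theorem core (x y w : Fin I.n) : A.Core x y w ↔ w ∈ CRCS.core I.G x y := by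
  simp only [Arrays.Core, CRCS.core, Set.mem_ofPred_eq, h.size, Fin.forall_iff, ← h.adj]

theorem uniqueIn (x y v : Fin I.n) :
    A.Uniq x y v ↔ UniqueIn I.fs (CRCS.core I.G x y) v := by
  simp only [Arrays.Uniq, UniqueIn, h.size, Fin.forall_iff, ← h.core, Fin.ext_iff, ← h.source]

theorem active (x y : Fin I.n) : A.Act x y ↔ Active I.G I.fs x y := by
  simp only [Arrays.Act, Active, h.adj, h.uniqueIn]

theorem cond : A.Cond ↔ Cond I.G I.fs I.ft := by
  simp only [Arrays.Cond, Cond, h.size, Fin.forall_iff, Fin.exists_iff, ← h.core, ← h.active,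
    ← h.uniqueIn, Fin.ext_iff, ← h.source, ← h.target, exists_prop]

end Represents

end Encoding

end CRCS

/-! ### Row offsets and the complete program. -/

namespace RAM

/-- The program that stores `2 + u * n` in the array `1` at every index `u ≤ n`, where `n` is the
entry `0` of the array `0`. -/
def offsetProg : Prog :=
  .seq (.assign 1 (.const 0)) (.seq (.assign 2 (.const 2))
    -- Repeated addition replaces multiplication. The extra index `n` is needed because its offset
    -- is where the colors of `fs` begin.
    (.loop (.lt (.var 1) (.add (.get 0 (.const 0)) (.const 1)))
      (.seq (.store 1 (.var 1) (.var 2)) (.seq (.assign 2 (.add (.var 2) (.get 0 (.const 0))))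
        (.assign 1 (.add (.var 1) (.const 1)))))))

theorem exists_exec_offsetProg (s : State) :
    ∃ t s', Exec offsetProg s t s' ∧ t ≤ (s.arr 0 0 + 1) * 19 + 11 ∧ s'.arr 0 = s.arr 0 ∧
      ∀ u ≤ s.arr 0 0, s'.arr 1 u = 2 + u * s.arr 0 0 := by
  have hexec := exists_exec_loop (n := s.arr 0 0 + 1) (T := 12)
    (e := .lt (.var 1) (.add (.get 0 (.const 0)) (.const 1)))
    (p := .seq (.store 1 (.var 1) (.var 2)) (.seq (.assign 2 (.add (.var 2) (.get 0 (.const 0))))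
        (.assign 1 (.add (.var 1) (.const 1)))))
    (fun i s' => s'.arr 0 = s.arr 0 ∧ s'.var 1 = i ∧ s'.var 2 = 2 + i * s.arr 0 0 ∧
      ∀ u < i, s'.arr 1 u = 2 + u * s.arr 0 0) ?_ ?_ ?_
    (s := (s.setVar 1 0).setVar 2 2) (by simp [State.setVar])
  · obtain ⟨t, s', h1, h2, h3, -, -, h4⟩ := hexec
    refine ⟨_, s', .seq (.assign s 1 _) (.seq (.assign _ 2 _) h1), ?_, h3,
      fun u hu => h4 u (by omega)⟩
    simp only [Expr.cost] at h2 ⊢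
    omega
  · rintro i s' hi ⟨h1, h2, -⟩
    simp [Expr.eval, h1, h2]; omega
  · rintro s' ⟨h1, h2, -⟩
    simp [Expr.eval, h1, h2]
  · rintro i s' hi ⟨h1, h2, h3, h4⟩
    refine ⟨_, _, .seq (.store s' 1 _ _) (.seq (.assign _ 2 _) (.assign _ 1 _)),
      by simp [Expr.cost], ?_, ?_, ?_, fun u hu => ?_⟩
    · simp [State.setVar, State.setArr, h1]
    · simp [State.setVar, State.setArr, Expr.eval, h2]
    · simp [State.setVar, State.setArr, Expr.eval, h1, h3]; ring
    · rcases Nat.lt_succ_iff_lt_or_eq.1 hu with hu | rfl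
      · simp [State.setVar, State.setArr, Expr.eval, h2, hu.ne, h4 u hu]
      · simp [State.setVar, State.setArr, Expr.eval, h2, h3]

end RAM

theorem mainTheorem5 :
    RAM.SolvableInPolyTime CRCS.Instance.encode
      (fun I : CRCS.Instance => CRCS.IsCograph I.G) CRCS.Instance.IsYes := by
  obtain ⟨-, p, b, hp⟩ := RAM.polyDecidable_cond 3
  refine ⟨.seq RAM.offsetProg (.seq p (.assign 0 (.var 3))),
    (Polynomial.X + 1) * 19 + 11 + (b + 2), fun I hI => ?_⟩
  obtain ⟨t₁, s₁, h1, h2, h3, h4⟩ := RAM.exists_exec_offsetProg (RAM.State.init I.encode)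
  have hn : (RAM.State.init I.encode).arr 0 0 = I.n := I.getD_encode_zero
  rw [hn] at h2 h4
  have hrep : CRCS.Represents s₁.arr I := ⟨fun i => by rw [h3]; rfl, h4⟩
  obtain ⟨t₂, s₂, g1, g2, -, -, g3, g4⟩ := hp s₁
  -- The cograph hypothesis enters only here; the program halts within its bound on any arrays.
  have hyes : RAM.Arrays.Cond s₁.arr ↔ I.IsYes :=
    hrep.cond.trans (CRCS.reconfigurable_iff_cond hI.p4Free I.fs I.ft).symm
  rw [hrep.size] at g2
  beta_reduce at g3 g4
  rw [hyes] at g3 g4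
  refine ⟨_, _, .seq h1 (.seq g1 (.assign s₂ 0 _)), le_trans ?_
    (RAM.eval_le_eval _ I.n_le_inputSize), fun h => ?_, fun h => ?_⟩
  · simp [RAM.Expr.cost]; omega
  · simp [RAM.State.setVar, RAM.Expr.eval, g3 h]
  · simp [RAM.State.setVar, RAM.Expr.eval, g4 h]
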